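/- Let $F$ be a free group and let $w\in F$ be a nontrivial element with $w\in[F,F]$. For $v$ in a free group $F'$ and a group $G$, a $v$-word in $G$ is the image of $v$ under a homomorphism $F'\to G$. For $g$ in the subgroup of $G$ generated by the $v$-words, let $\mathrm{l}(g|v)$ be the minimum number of $v$-words and inverses of $v$-words in $G$ whose product is $g$, and let $\mathrm{sl}(g|v)=\lim_{n\to\infty}\mathrm{l}(g^n|v)/n$. Let $\mathrm{scl}(g)=\mathrm{sl}(g|[x,y])$, where $[x,y]=xyx^{-1}y^{-1}$ in the free group on $x,y$. Then, with $G=F$, the limits defining $\mathrm{scl}(w)$ and $\mathrm{sl}(w|w)$ exist and $$\frac12\le\frac{\mathrm{scl}(w)}{\mathrm{scl}(w)+\frac12}\le\mathrm{sl}(w|w)\le 1 .$$ -/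

import Mathlib

open Filter Topology
open scoped commutatorElement

namespace StableWLength

/-- A `W`-word in a group `G`: the image of some `w ∈ W` under a homomorphism `F →* G`
(`F` is a free group in all uses). -/
def IsWWord {F : Type*} [Group F] (W : Set F) {G : Type*} [Group G] (g : G) : Prop :=
  ∃ w ∈ W, ∃ φ : F →* G, φ w = g

/-- The verbal subgroup `G_W`, generated by the `W`-words in `G`. -/
def verbalSubgroup {F : Type*} [Group F] (W : Set F) (G : Type*) [Group G] : Subgroup G :=
  Subgroup.closure {g : G | IsWWord W g}

/-- `g` is a product of exactly `n` factors, each a `W`-word in `G` or the inverse of one. -/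
def IsWProduct {F : Type*} [Group F] (W : Set F) {G : Type*} [Group G] (n : ℕ) (g : G) : Prop :=
  ∃ l : List G, l.length = n ∧ (∀ x ∈ l, IsWWord W x ∨ IsWWord W x⁻¹) ∧ l.prod = g

/-- Such expressions exist precisely for the elements of the verbal subgroup. -/
theorem exists_isWProduct_iff {F : Type*} [Group F] (W : Set F) {G : Type*} [Group G] (g : G) :
    (∃ n, IsWProduct W n g) ↔ g ∈ verbalSubgroup W G := by
  rw [verbalSubgroup, ← Subgroup.mem_toSubmonoid, Subgroup.closure_toSubmonoid]
  constructor
  · rintro ⟨n, l, -, hl, rfl⟩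
    exact Submonoid.list_prod_mem _ fun x hx => Submonoid.subset_closure (hl x hx)
  · intro hg
    obtain ⟨l, hl, rfl⟩ := Submonoid.exists_list_of_mem_closure hg
    exact ⟨l.length, l, rfl, hl, rfl⟩

/-- The `W`-length `l_G(g|W)`: the minimum number of `W`-words and their inverses in `G` whose
product is `g`. It is meaningful for `g ∈ G_W`, where the set below is nonempty (and the minimum
is attained). -/
noncomputable def wLength {F : Type*} [Group F] (W : Set F) {G : Type*} [Group G] (g : G) : ℕ :=
  sInf {n : ℕ | IsWProduct W n g}

/-- The stable `W`-length `sl_G(g|W) = lim l_G(g ^ n|W) / n`, for `g ∈ G_W`. -/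
noncomputable def stableWLength {F : Type*} [Group F] (W : Set F) {G : Type*} [Group G]
    (g : G) : ℝ :=
  limUnder atTop fun n : ℕ => (wLength W (g ^ n) : ℝ) / n

/-- The word `[x, y] = x y x⁻¹ y⁻¹` in the free group on `x` and `y`. -/
def commutatorWord : FreeGroup (Fin 2) := ⁅FreeGroup.of (0 : Fin 2), FreeGroup.of (1 : Fin 2)⁆

/-- Commutator length: `[x, y]`-length. -/
noncomputable def cl {G : Type*} [Group G] (g : G) : ℕ := wLength {commutatorWord} g

/-- Stable commutator length: stable `[x, y]`-length. -/
noncomputable def scl {G : Type*} [Group G] (g : G) : ℝ := stableWLength {commutatorWord} g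

end StableWLength

namespace StableWLength

/-! ### Lengths with respect to words, and their limits -/

section WProduct

variable {F : Type*} [Group F] {W : Set F} {G : Type*} [Group G]

/-! Middle inequality (`IsWProduct.mul_scl_le`): let `w ^ j` be a product of `k` factors, each a
`w`-word or the inverse of one, and let `n = 2m + 1`. Up to `m` commutators per factor, the `n`-th
power of the product is the product of the `n`-th powers, each of which is an image of `w ^ n` or
the inverse of one. So `cl (w ^ (j * n)) ≤ k * (cl (w ^ n) + m)`; division by `n` gives `j * scl w ≤
k * (scl w + 1/2)` in the limit.

First inequality: it amounts to `scl w ≥ 1/2` (`half_le_scl`). The free group acts on the line,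
commuting with translation by some `L`, so that `w ^ n` moves a point down by `n * L`. A commutator
moves no point down by more than `2 * L`, so `n ≤ 2 * cl (w ^ n)`. -/

theorem IsWWord.map {H : Type*} [Group H] {g : G} (h : IsWWord W g) (ψ : G →* H) :
    IsWWord W (ψ g) := by
  obtain ⟨w, hw, φ, rfl⟩ := h
  exact ⟨w, hw, ψ.comp φ, rfl⟩

theorem IsWProduct.one : IsWProduct W 0 (1 : G) := ⟨[], by simp⟩

theorem IsWProduct.mul {m n : ℕ} {g h : G} (hg : IsWProduct W m g) (hh : IsWProduct W n h) :
    IsWProduct W (m + n) (g * h) := by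
  obtain ⟨l, rfl, hl, rfl⟩ := hg
  obtain ⟨l', rfl, hl', rfl⟩ := hh
  refine ⟨l ++ l', by simp, fun x hx => ?_, by simp⟩
  rcases List.mem_append.1 hx with hx | hx
  exacts [hl x hx, hl' x hx]

theorem IsWProduct.map {H : Type*} [Group H] {n : ℕ} {g : G} (h : IsWProduct W n g) (ψ : G →* H) :
    IsWProduct W n (ψ g) := by
  obtain ⟨l, rfl, hl, rfl⟩ := h
  refine ⟨l.map ψ, by simp, fun x hx => ?_, by simp [map_list_prod]⟩
  obtain ⟨y, hy, rfl⟩ := List.mem_map.1 hx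
  rw [← map_inv]
  exact (hl y hy).imp (fun h => h.map ψ) fun h => h.map ψ

theorem IsWProduct.inv {n : ℕ} {g : G} (h : IsWProduct W n g) : IsWProduct W n g⁻¹ := by
  obtain ⟨l, rfl, hl, rfl⟩ := h
  refine ⟨(l.map (·⁻¹)).reverse, by simp, fun x hx => ?_, by simp [List.prod_inv_reverse]⟩
  obtain ⟨y, hy, rfl⟩ := List.mem_map.1 (List.mem_reverse.1 hx)
  rw [inv_inv]
  exact (hl y hy).symm

theorem IsWProduct.conj {n : ℕ} {g : G} (h : IsWProduct W n g) (a : G) :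
    IsWProduct W n (a * g * a⁻¹) := h.map (MulAut.conj a).toMonoidHom

theorem isWProduct_wLength {g : G} (hg : g ∈ verbalSubgroup W G) :
    IsWProduct W (wLength W g) g :=
  Nat.sInf_mem (s := {n | IsWProduct W n g}) ((exists_isWProduct_iff W g).2 hg)

theorem IsWProduct.wLength_le {n : ℕ} {g : G} (h : IsWProduct W n g) : wLength W g ≤ n :=
  Nat.sInf_le h

theorem subadditive_wLength_pow {g : G} (hg : g ∈ verbalSubgroup W G) :
    Subadditive fun n : ℕ => (wLength W (g ^ n) : ℝ) := by
  intro m n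
  have := ((isWProduct_wLength (pow_mem hg m)).mul (isWProduct_wLength (pow_mem hg n))).wLength_le
  rw [← pow_add] at this
  simpa only [← Nat.cast_add, Nat.cast_le] using this

/-- Fekete's lemma; without convergence `limUnder` would be a junk value. -/
theorem tendsto_stableWLength {g : G} (hg : g ∈ verbalSubgroup W G) :
    Tendsto (fun n : ℕ => (wLength W (g ^ n) : ℝ) / n) atTop (𝓝 (stableWLength W g)) :=
  tendsto_nhds_limUnder ⟨_, (subadditive_wLength_pow hg).tendsto_lim
    ⟨0, by rintro _ ⟨n, rfl⟩; positivity⟩⟩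

end WProduct

/-! ### Powers of products modulo commutators -/

section Commutator

variable {G : Type*} [Group G]

theorem isWWord_commutatorWord_iff {g : G} :
    IsWWord {commutatorWord} g ↔ ∃ a b : G, ⁅a, b⁆ = g := by
  constructor
  · rintro ⟨_, rfl, φ, rfl⟩
    exact ⟨_, _, (map_commutatorElement φ _ _).symm⟩
  · rintro ⟨a, b, rfl⟩
    exact ⟨_, rfl, FreeGroup.lift ![a, b], by simp [commutatorWord, map_commutatorElement]⟩

theorem isWProduct_commutatorElement (a b : G) : IsWProduct {commutatorWord} 1 ⁅a, b⁆ :=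
  ⟨[⁅a, b⁆], by simp [isWWord_commutatorWord_iff]⟩

theorem verbalSubgroup_commutatorWord : verbalSubgroup {commutatorWord} G = commutator G := by
  simp only [verbalSubgroup, isWWord_commutatorWord_iff, commutator_eq_closure, commutatorSet]

/-- Raising the exponent by two costs a single commutator, hence the odd exponents and, in the end,
the constant `1/2`. -/
theorem isWProduct_mul_pow (a b : G) (m : ℕ) : ∃ c : G, IsWProduct {commutatorWord} m c ∧
    (a * b) ^ (2 * m + 1) = c * (a ^ (2 * m + 1) * b ^ (2 * m + 1)) := by
  induction m with
  | zero => exact ⟨1, IsWProduct.one, by simp⟩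
  | succ m ih =>
    obtain ⟨c, hc, h⟩ := ih
    rw [show 2 * (m + 1) + 1 = 2 * m + 1 + 2 by omega]
    generalize 2 * m + 1 = n at h ⊢
    have key : a ^ n * b ^ n * ((a * b) * (a * b)) =
        (a ^ n * ⁅b ^ n * (a * b), a * (b ^ n)⁻¹⁆ * (a ^ n)⁻¹) *
          (a ^ n * (a * a) * (b * b ^ n * b)) := by
      generalize a ^ n = A
      generalize b ^ n = B
      rw [commutatorElement_def]
      group
    refine ⟨_, hc.mul ((isWProduct_commutatorElement (b ^ n * (a * b)) (a * (b ^ n)⁻¹)).conj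
      (a ^ n)), ?_⟩
    rw [pow_add, h, pow_two, mul_assoc c, key, mul_assoc c,
      pow_add a n, pow_two, ← pow_succ', ← pow_succ]

/-- Each factor is charged `m` commutators for being split off; the last one needs none, but this is
immaterial for long products. -/
theorem isWProduct_list_prod_pow (m k : ℕ) (l : List G)
    (hl : ∀ x ∈ l, IsWProduct {commutatorWord} k (x ^ (2 * m + 1))) :
    IsWProduct {commutatorWord} (l.length * (k + m)) (l.prod ^ (2 * m + 1)) := by
  induction l with
  | nil => simpa using IsWProduct.one
  | cons x l ih =>
    obtain ⟨c, hc, h⟩ := isWProduct_mul_pow x l.prod m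
    rw [List.prod_cons, h, List.length_cons,
      show (l.length + 1) * (k + m) = m + (k + l.length * (k + m)) by ring]
    exact hc.mul ((hl x (by simp)).mul (ih fun y hy => hl y (by simp [hy])))

end Commutator

/-! ### Homeomorphisms of the line commuting with a translation -/

section Translation

variable {L : ℝ}

/-- The order automorphisms of the line that commute with the translation by `L`. -/
def periodicOrderIso (L : ℝ) : Subgroup (ℝ ≃o ℝ) := Subgroup.centralizer {OrderIso.addRight L}

theorem mem_periodicOrderIso_iff {e : ℝ ≃o ℝ} :
    e ∈ periodicOrderIso L ↔ ∀ t, e (t + L) = e t + L := by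
  rw [periodicOrderIso, Subgroup.mem_centralizer_singleton_iff]
  exact DFunLike.ext_iff

theorem map_add_zsmul_of_mem {e : ℝ ≃o ℝ} (he : e ∈ periodicOrderIso L) (t : ℝ) (n : ℤ) :
    e (t + n • L) = e t + n • L := by
  rw [mem_periodicOrderIso_iff] at he
  induction n with
  | zero => simp
  | succ n ih => rw [add_zsmul, one_zsmul, ← add_assoc, he, ih, add_assoc]
  | pred n ih =>
    have := he (t + (-(n : ℤ) - 1) • L)
    rw [sub_zsmul, one_zsmul] at this ⊢
    rw [show t + (-(n : ℤ) • L + -L) + L = t + -(n : ℤ) • L by ring, ih] at this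
    linarith

/-- Multiples of `L` can be absorbed into `a` and `b`, so that both move `t` up by less than `L`;
then `a (b t) ≤ t + 2 * L`, whereas `t ≤ b (a t)`. -/
theorem apply_apply_le_of_mem (hL : 0 < L) {a b : ℝ ≃o ℝ} (ha : a ∈ periodicOrderIso L)
    (hb : b ∈ periodicOrderIso L) (t : ℝ) : a (b t) ≤ b (a t) + 2 * L := by
  obtain ⟨m, ⟨hm1, hm2⟩, -⟩ := existsUnique_add_zsmul_mem_Ico hL (a t) t
  obtain ⟨n, ⟨hn1, hn2⟩, -⟩ := existsUnique_add_zsmul_mem_Ico hL (b t) t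
  have h1 : a (b t + n • L) ≤ a (t + L) := a.monotone hn2.le
  have h2 : b t ≤ b (a t + m • L) := b.monotone hm1
  rw [map_add_zsmul_of_mem ha, mem_periodicOrderIso_iff.1 ha] at h1
  rw [map_add_zsmul_of_mem hb] at h2
  linarith

theorem le_commutatorElement_apply (hL : 0 < L) {a b : ℝ ≃o ℝ} (ha : a ∈ periodicOrderIso L)
    (hb : b ∈ periodicOrderIso L) (t : ℝ) : t - 2 * L ≤ ⁅a, b⁆ t := by
  have := apply_apply_le_of_mem hL hb ha (a⁻¹ (b⁻¹ t))
  rw [RelIso.apply_inv_self, RelIso.apply_inv_self] at this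
  change t - 2 * L ≤ a (b (a⁻¹ (b⁻¹ t)))
  linarith

theorem IsWProduct.le_apply {G : Type*} [Group G] (hL : 0 < L) {ρ : G →* (ℝ ≃o ℝ)}
    (hρ : ∀ g, ρ g ∈ periodicOrderIso L) {n : ℕ} {g : G} (h : IsWProduct {commutatorWord} n g)
    (t : ℝ) : t - n * (2 * L) ≤ ρ g t := by
  obtain ⟨l, rfl, hl, rfl⟩ := h
  induction l generalizing t with
  | nil => simp
  | cons x l ih =>
    have h1 := ih t fun y hy => hl y (by simp [hy])
    obtain ⟨a, b, rfl⟩ : ∃ a b : G, ⁅a, b⁆ = x := by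
      rcases hl x (by simp) with h | h
      · exact isWWord_commutatorWord_iff.1 h
      · obtain ⟨a, b, h⟩ := isWWord_commutatorWord_iff.1 h
        exact ⟨b, a, by rw [← commutatorElement_inv, h, inv_inv]⟩
    have h2 := le_commutatorElement_apply hL (hρ a) (hρ b) (ρ l.prod t)
    rw [List.prod_cons, map_mul, map_commutatorElement, RelIso.mul_apply, List.length_cons]
    push_cast
    linarith

/-- A strictly increasing sequence that commutes with a translation extends to an order
automorphism of the line that commutes with this translation. -/
theorem exists_periodicOrderIso_extending {N : ℕ} (hN : 0 < N) (f : ℤ → ℝ) (hf : StrictMono f)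
    (hper : ∀ k, f (k + N) = f k + N) :
    ∃ e ∈ periodicOrderIso (N : ℝ), ∀ k : ℤ, e k = f k := by
  -- Linear interpolation between consecutive integers.
  set g : ℝ → ℝ := fun t => f ⌊t⌋ + Int.fract t * (f (⌊t⌋ + 1) - f ⌊t⌋) with hg
  have hpos : ∀ k, 0 < f (k + 1) - f k := fun k => sub_pos.2 (hf (by omega))
  have hg1 : ∀ t, f ⌊t⌋ ≤ g t := fun t =>
    le_add_of_nonneg_right (mul_nonneg (Int.fract_nonneg t) (hpos _).le)
  have hg2 : ∀ t, g t < f (⌊t⌋ + 1) := fun t => by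
    have := mul_lt_mul_of_pos_right (Int.fract_lt_one t) (hpos ⌊t⌋)
    simp only [hg]; linarith
  have hmono : StrictMono g := by
    intro s t hst
    rcases (Int.floor_mono hst.le).eq_or_lt with h | h
    · have h1 : Int.fract s < Int.fract t := by
        unfold Int.fract; rw [h]; linarith
      have := mul_lt_mul_of_pos_right h1 (hpos ⌊t⌋)
      simp only [hg, h]; linarith
    · exact (hg2 s).trans_le ((hf.monotone (by omega)).trans (hg1 t))
  have hperz : ∀ (n k : ℤ), f (k + n * N) = f k + n * N := by
    intro n
    induction n with
    | zero => simp
    | succ n ih =>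
      intro k
      rw [show k + ((n : ℤ) + 1) * N = k + n * N + N by ring, hper, ih]; push_cast; ring
    | pred n ih =>
      intro k
      have := hper (k + (-(n : ℤ) - 1) * N)
      rw [show k + (-(n : ℤ) - 1) * N + N = k + -(n : ℤ) * N by ring, ih] at this
      push_cast at this ⊢; linarith
  have hsurj : Function.Surjective g := by
    intro y
    have hN' : (0 : ℝ) < N := by exact_mod_cast hN
    obtain ⟨m, hm⟩ := exists_int_gt ((y - f 0) / N)
    obtain ⟨m', hm'⟩ := exists_int_lt ((y - f 0) / N)
    rw [div_lt_iff₀ hN'] at hm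
    rw [lt_div_iff₀ hN'] at hm'
    obtain ⟨k, hk, hk'⟩ := Int.exists_greatest_of_bdd (P := fun k => f k ≤ y)
      ⟨m * N, fun z hz => le_of_not_gt fun h => by
        have h1 := hf h
        have h2 := hperz m 0
        rw [zero_add] at h2
        linarith⟩
      ⟨m' * N, by have h2 := hperz m' 0; rw [zero_add] at h2; linarith⟩
    have hk'' : y < f (k + 1) := lt_of_not_ge fun h => by have := hk' _ h; omega
    set r := (y - f k) / (f (k + 1) - f k) with hr
    have hr0 : 0 ≤ r := div_nonneg (by linarith) (hpos k).le
    have hr1 : r < 1 := (div_lt_one (hpos k)).2 (by linarith)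
    have hfl : ⌊(k : ℝ) + r⌋ = k := by
      rw [Int.floor_eq_iff]; constructor <;> linarith
    refine ⟨k + r, ?_⟩
    simp only [hg, Int.fract, hfl]
    rw [add_sub_cancel_left, hr, div_mul_cancel₀ _ (hpos k).ne']
    ring
  refine ⟨hmono.orderIsoOfSurjective g hsurj, mem_periodicOrderIso_iff.2 fun t => ?_, fun k => ?_⟩
  · change g (t + N) = g t + N
    simp only [hg, Int.floor_add_natCast, Int.fract_add_natCast]
    rw [show ⌊t⌋ + (N : ℤ) + 1 = ⌊t⌋ + 1 + N by ring, hper, hper]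
    ring
  · change g k = f k
    simp [hg]

end Translation

/-! ### Actions of free groups on the line -/

section FreeGroup

variable {α : Type*}

/-- A periodic bi-infinite reduced word lets every generator act on the line: the generator moves
`k + 1` to `k` if it is the letter at `k`, and `k` to `k + 1` if its inverse is. -/
theorem exists_periodicOrderIso_of_reduced {N : ℕ} (hN : 0 < N) (c : ℤ → α × Bool)
    (hper : ∀ k, c (k + N) = c k) (hred : ∀ k, (c k).1 = (c (k + 1)).1 → (c k).2 = (c (k + 1)).2)
    (x : α) : ∃ e ∈ periodicOrderIso (N : ℝ),
      ∀ k : ℤ, (c k = (x, true) → e ((k + 1 : ℤ) : ℝ) = k) ∧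
        (c k = (x, false) → e k = (k + 1 : ℤ)) := by
  classical
  -- The first two values are prescribed. The shifts by `1 / 4` make room where `k + 1` is sent to
  -- `k` or `k - 1` is sent to `k`. Reducedness excludes conflicts.
  let f : ℤ → ℝ := fun k =>
    if c (k - 1) = (x, true) then k - 1
    else if c k = (x, false) then k + 1
    else if c k = (x, true) then k - 1 / 4
    else if c (k - 1) = (x, false) then k + 1 / 4
    else k
  have hred1 : ∀ k, c k = (x, true) → c (k + 1) ≠ (x, false) := fun k h1 h2 => by
    have := hred k; simp [h1, h2] at this
  have hred2 : ∀ k, c k = (x, false) → c (k + 1) ≠ (x, true) := fun k h1 h2 => by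
    have := hred k; simp [h1, h2] at this
  have hf : StrictMono f := by
    refine strictMono_int_of_lt_succ fun k => ?_
    have h1 := hred1 k
    have h2 := hred2 k
    have h3 := hred1 (k - 1)
    have h4 := hred2 (k - 1)
    rw [sub_add_cancel] at h3 h4
    simp only [f, add_sub_cancel_right]
    push_cast
    split_ifs <;> first | linarith | simp_all
  obtain ⟨e, he, hef⟩ := exists_periodicOrderIso_extending hN f hf (fun k => by
    have : c (k + N - 1) = c (k - 1) := by rw [← hper (k - 1)]; congr 1; ring
    simp only [f, hper, this]
    push_cast
    split_ifs <;> ring)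
  refine ⟨e, he, fun k => ⟨fun h => ?_, fun h => ?_⟩⟩
  · rw [hef]; simp [f, h]
  · have : c (k - 1) ≠ (x, true) := fun h' => hred1 _ h' (by simpa using h)
    rw [hef]; simp [f, h, this]

theorem exists_action_of_isCyclicallyReduced {l : List (α × Bool)} (hl : l ≠ [])
    (hred : FreeGroup.IsCyclicallyReduced l) :
    ∃ ρ : FreeGroup α →* (ℝ ≃o ℝ), (∀ g, ρ g ∈ periodicOrderIso (l.length : ℝ)) ∧
      ρ (FreeGroup.mk l) l.length = 0 := by
  have hN : 0 < l.length := List.length_pos_iff.2 hl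
  have hN' : (0 : ℤ) < l.length := by exact_mod_cast hN
  have hlt : ∀ k : ℤ, (k % l.length).toNat < l.length := fun k => by
    have := Int.emod_lt_of_pos k hN'
    have := Int.emod_nonneg k hN'.ne'
    omega
  let c : ℤ → α × Bool := fun k => l[(k % l.length).toNat]'(hlt k)
  have hc : ∀ (i : ℕ) (hi : i < l.length), c i = l[i] := fun i hi => by
    have : ((i : ℤ) % l.length).toNat = i := by
      rw [Int.emod_eq_of_lt (by omega) (by omega)]; simp
    simp only [c, this]
  have hper : ∀ k, c (k + l.length) = c k := fun k => by simp [c]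
  have hcred : ∀ k, (c k).1 = (c (k + 1)).1 → (c k).2 = (c (k + 1)).2 := by
    intro k
    have h0 := Int.emod_nonneg k hN'.ne'
    have h1 := hlt k
    by_cases h : (k % l.length).toNat + 1 < l.length
    · have : ((k + 1) % l.length).toNat = (k % l.length).toNat + 1 := by
        rw [← Int.emod_add_emod, Int.emod_eq_of_lt (by omega) (by omega)]; omega
      simp only [c, this]
      exact List.isChain_iff_getElem.1 hred.1 _ h
    · have h2 : ((k + 1) % l.length).toNat = 0 := by
        rw [← Int.emod_add_emod, show k % l.length + 1 = l.length by omega]; simp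
      have h3 : (k % l.length).toNat = l.length - 1 := by omega
      simp only [c, h2, h3]
      exact hred.2 _ (by simp [List.getLast?_eq_getElem?]) _ (by simp [List.head?_eq_getElem?])
  choose e he hec using exists_periodicOrderIso_of_reduced hN c hper hcred
  -- The letter at position `i` moves `i + 1` to `i`, so a prefix, whose last letter acts first,
  -- walks down to `0`.
  have key : ∀ i : ℕ, i ≤ l.length → FreeGroup.lift e (FreeGroup.mk (l.take i)) (i : ℝ) = 0 := by
    intro i
    induction i with
    | zero => intro _; simp [← FreeGroup.one_eq_mk]
    | succ i ih =>
      intro hi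
      rw [List.take_succ_eq_append_getElem hi, ← FreeGroup.mul_mk, map_mul, RelIso.mul_apply]
      suffices h : FreeGroup.lift e (FreeGroup.mk [l[i]]) ((i + 1 : ℕ) : ℝ) = i by
        rw [h, ih (by omega)]
      have h1 := hec l[i].1 i
      rw [hc i hi] at h1
      rcases h : l[i] with ⟨x, _ | _⟩
      · rw [h] at h1
        have h2 := h1.2 rfl
        simp only [FreeGroup.lift_mk, List.map_cons, List.map_nil, List.prod_singleton, cond_false]
        push_cast at h2 ⊢
        rw [← h2, RelIso.inv_apply_self]
      · rw [h] at h1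
        have h2 := h1.1 rfl
        simp only [FreeGroup.lift_mk, List.map_cons, List.map_nil, List.prod_singleton, cond_true]
        push_cast at h2 ⊢
        exact h2
  refine ⟨FreeGroup.lift e, fun g => ?_, ?_⟩
  · have : (FreeGroup.lift e).range ≤ periodicOrderIso (l.length : ℝ) := by
      refine FreeGroup.range_lift_le ?_
      rintro _ ⟨x, rfl⟩
      exact he x
    exact this ⟨g, rfl⟩
  · simpa using key _ le_rfl

/-- Every nontrivial element of a free group acts on the line by a full negative turn at some
point, for some action that commutes with a translation. -/
theorem exists_action_of_ne_one {F : Type*} [Group F] [IsFreeGroup F] {w : F} (hw : w ≠ 1) :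
    ∃ L : ℝ, 0 < L ∧ ∃ ρ : F →* (ℝ ≃o ℝ), (∀ g, ρ g ∈ periodicOrderIso L) ∧
      ∃ t, ρ w (t + L) = t := by
  classical
  set φ := IsFreeGroup.toFreeGroup F
  set v := φ w
  have hv : v ≠ 1 := by simpa [v] using hw
  set l := FreeGroup.reduceCyclically v.toWord
  set u := FreeGroup.mk (FreeGroup.reduceCyclically.conjugator v.toWord)
  have huv : u * FreeGroup.mk l * u⁻¹ = v := by
    rw [FreeGroup.inv_mk, FreeGroup.mul_mk, FreeGroup.mul_mk,
      FreeGroup.reduceCyclically.conj_conjugator_reduceCyclically, FreeGroup.mk_toWord]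
  have hl : l ≠ [] := fun h => hv (by rw [← huv, h, ← FreeGroup.one_eq_mk]; simp)
  obtain ⟨ρ, hρ, h⟩ := exists_action_of_isCyclicallyReduced hl
    (FreeGroup.reduceCyclically.isCyclicallyReduced FreeGroup.isReduced_toWord)
  -- The cyclic reduction moves `l.length` to `0`; conjugation by `u` transports this to the point
  -- `ρ u 0`.
  refine ⟨l.length, by exact_mod_cast List.length_pos_iff.2 hl, ρ.comp φ.toMonoidHom,
    fun g => hρ _, ρ u 0, ?_⟩
  change ρ v _ = _
  rw [← mem_periodicOrderIso_iff.1 (hρ u), zero_add, ← huv, map_mul, map_mul, RelIso.mul_apply,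
    RelIso.mul_apply, map_inv, RelIso.inv_apply_self, h]

theorem le_two_mul_cl_pow {F : Type*} [Group F] [IsFreeGroup F] {w : F} (hw : w ≠ 1)
    (hwF : w ∈ commutator F) (n : ℕ) : n ≤ 2 * cl (w ^ n) := by
  obtain ⟨L, hL, ρ, hρ, t, ht⟩ := exists_action_of_ne_one hw
  have h1 : ∀ n : ℕ, ρ (w ^ n) (t + n * L) = t := by
    intro n
    induction n with
    | zero => simp
    | succ n ih =>
      have h2 : ρ w (t + L + (n : ℤ) • L) = t + n * L := by
        rw [map_add_zsmul_of_mem (hρ w), ht]; simp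
      rw [pow_succ, map_mul, RelIso.mul_apply,
        show t + ((n + 1 : ℕ) : ℝ) * L = t + L + (n : ℤ) • L by simp; ring, h2, ih]
  have h2 := (isWProduct_wLength (pow_mem (verbalSubgroup_commutatorWord (G := F) ▸ hwF) n)).le_apply
    hL hρ (t + n * L)
  rw [h1] at h2
  have h3 : (n : ℝ) * L ≤ (2 * cl (w ^ n) : ℕ) * L := by
    push_cast [cl]; linarith
  exact_mod_cast le_of_mul_le_mul_right h3 hL

end FreeGroup

theorem half_le_scl {F : Type*} [Group F] [IsFreeGroup F] {w : F} (hw : w ≠ 1)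
    (hwF : w ∈ commutator F) : 1 / 2 ≤ scl w := by
  refine ge_of_tendsto (tendsto_stableWLength (verbalSubgroup_commutatorWord (G := F) ▸ hwF)) ?_
  filter_upwards [eventually_gt_atTop 0] with n hn
  have h : (n : ℝ) ≤ 2 * cl (w ^ n) := by exact_mod_cast le_two_mul_cl_pow hw hwF n
  have hn' : (0 : ℝ) < n := by exact_mod_cast hn
  rw [le_div_iff₀ hn']
  rw [cl] at h
  linarith

theorem IsWProduct.mul_scl_le {G : Type*} [Group G] {w : G} (hw : w ∈ commutator G) {j k : ℕ}
    (hj : 0 < j) (h : IsWProduct {w} k (w ^ j)) : j * scl w ≤ k * (scl w + 1 / 2) := by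
  have hw' : w ∈ verbalSubgroup {commutatorWord} G := verbalSubgroup_commutatorWord (G := G) ▸ hw
  have hlim : Tendsto (fun n : ℕ => (cl (w ^ n) : ℝ) / n) atTop (𝓝 (scl w)) :=
    tendsto_stableWLength hw'
  -- Since the limits exist, odd exponents suffice to compute them.
  have hodd : Tendsto (fun m : ℕ => 2 * m + 1) atTop atTop :=
    tendsto_atTop_mono (fun m => show m ≤ _ by omega) tendsto_id
  have h1 : Tendsto (fun m : ℕ => j * ((cl (w ^ (j * (2 * m + 1))) : ℝ) / (j * (2 * m + 1) : ℕ)))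
      atTop (𝓝 (j * scl w)) :=
    (hlim.comp (tendsto_atTop_mono (fun m => by nlinarith) hodd)).const_mul _
  have h2 : Tendsto (fun m : ℕ => k * ((cl (w ^ (2 * m + 1)) : ℝ) / (2 * m + 1 : ℕ) + 1 / 2))
      atTop (𝓝 (k * (scl w + 1 / 2))) :=
    ((hlim.comp hodd).add_const _).const_mul _
  refine le_of_tendsto_of_tendsto' h1 h2 fun m => ?_
  obtain ⟨l, rfl, hl, hprod⟩ := h
  have h3 : IsWProduct {commutatorWord} (l.length * (cl (w ^ (2 * m + 1)) + m))
      (w ^ (j * (2 * m + 1))) := by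
    rw [pow_mul, ← hprod]
    have hlen := isWProduct_wLength (pow_mem hw' (2 * m + 1))
    refine isWProduct_list_prod_pow m _ l fun x hx => ?_
    rcases hl x hx with ⟨_, rfl, φ, hφ⟩ | ⟨_, rfl, φ, hφ⟩
    · rw [← hφ, ← map_pow]
      exact hlen.map φ
    · rw [← inv_inv x, ← hφ, inv_pow, ← map_pow]
      exact (hlen.map φ).inv
  have h4 : (cl (w ^ (j * (2 * m + 1))) : ℝ) ≤ l.length * (cl (w ^ (2 * m + 1)) + m) := by
    exact_mod_cast h3.wLength_le
  have hj' : (0 : ℝ) < j := by exact_mod_cast hj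
  have hm : (0 : ℝ) < 2 * m + 1 := by positivity
  push_cast
  calc (j : ℝ) * (cl (w ^ (j * (2 * m + 1))) / (j * (2 * m + 1)))
      = cl (w ^ (j * (2 * m + 1))) / (2 * m + 1) := by field_simp
    _ ≤ l.length * (cl (w ^ (2 * m + 1)) + (2 * m + 1) / 2) / (2 * m + 1) := by
      gcongr
      refine h4.trans ?_
      gcongr
      linarith
    _ = _ := by field_simp

end StableWLength

theorem corollary2p17 {F : Type*} [Group F] [IsFreeGroup F] (w : F) (hw : w ≠ 1)
    (hwF : w ∈ commutator F) :
    Tendsto (fun n : ℕ => (StableWLength.cl (w ^ n) : ℝ) / n) atTop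
        (𝓝 (StableWLength.scl w)) ∧
      Tendsto (fun n : ℕ => (StableWLength.wLength {w} (w ^ n) : ℝ) / n) atTop
        (𝓝 (StableWLength.stableWLength {w} w)) ∧
      1 / 2 ≤ StableWLength.scl w / (StableWLength.scl w + 1 / 2) ∧
      StableWLength.scl w / (StableWLength.scl w + 1 / 2) ≤
        StableWLength.stableWLength {w} w ∧
      StableWLength.stableWLength {w} w ≤ 1 := by
  have hword : StableWLength.IsWWord {w} w := ⟨w, rfl, MonoidHom.id F, rfl⟩
  have hww : w ∈ StableWLength.verbalSubgroup {w} F := Subgroup.subset_closure hword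
  have hscl := StableWLength.half_le_scl hw hwF
  have hlim := StableWLength.tendsto_stableWLength hww
  refine ⟨StableWLength.tendsto_stableWLength
    (StableWLength.verbalSubgroup_commutatorWord (G := F) ▸ hwF), hlim, ?_, ?_, ?_⟩
  · rw [le_div_iff₀ (by linarith)]
    linarith
  · refine ge_of_tendsto hlim ?_
    filter_upwards [eventually_gt_atTop 0] with n hn
    have hn' : (0 : ℝ) < n := by exact_mod_cast hn
    rw [div_le_div_iff₀ (by linarith) hn', mul_comm]
    exact (StableWLength.isWProduct_wLength (pow_mem hww n)).mul_scl_le hwF hn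
  · refine le_of_tendsto' hlim fun n => div_le_one_of_le₀ ?_ n.cast_nonneg
    have : StableWLength.IsWProduct {w} n (w ^ n) :=
      ⟨List.replicate n w, by simp, fun x hx => Or.inl (List.eq_of_mem_replicate hx ▸ hword),
        by simp⟩
    exact_mod_cast this.wLength_le
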